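/- Let $f\colon\mathbb{R}^d\to\mathbb{R}$ be piecewise affine, i.e. there are finitely many polyhedral sets $Q_1,\dots,Q_k$ (finite intersections of closed half-spaces) with nonempty, pairwise disjoint interiors and with union $\mathbb{R}^d$, such that $f$ is affine on each $Q_i$. Suppose that $f$ is bounded below. Then: (1) $f$ attains its global minimum. (2) $f$ has a representation $$f(x)=\underline f(x)+\overline f(x),\qquad \underline f(x)=\max_{1\le i\le l}(a_i+\langle v_i,x\rangle),\qquad \overline f(x)=\min_{1\le j\le s}(b_j+\langle w_j,x\rangle)\qquad(*)$$ with $l,s\ge1$, $a_i,b_j\in\mathbb{R}$, $v_i,w_j\in\mathbb{R}^d$. (3) Fix any representation $(*)$ and any starting point $x_0\in\mathbb{R}^d$. For $x\in\mathbb{R}^d$ and $j\in J=\{1,\dots,s\}$ put $$\underline d f(x)=\mathrm{co}\{(a_i-\underline f(x)+\langle v_i,x\rangle,\,v_i): 1\le i\le l\}\subset\mathbb{R}\times\mathbb{R}^d,\qquad z_j(x)=(b_j-\overline f(x)+\langle w_j,x\rangle,\,w_j),$$ and let $(a_j(x),v_j(x))$ be the point of least Euclidean norm in $\underline d f(x)+z_j(x)$.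 The method of global codifferential descent starts with $n=0$, $M=J$, and repeats the following: remove from $M$ all $j$ with $a_j(x_n)\ge0$; if $M=\emptyset$, stop; otherwise choose $j(n)\in M$ minimizing $f\big(x_n+a_j(x_n)^{-1}v_j(x_n)\big)$ over $j\in M$, set $x_{n+1}=x_n+a_{j(n)}(x_n)^{-1}v_{j(n)}(x_n)$, and increase $n$ by one. The method can be carried out from $x_0$, and, whatever choices of the minimizing indices $j(n)$ are made, it stops after finitely many steps at a point $x_N$ of global minimum of $f$, the number $N$ of updates being at most $s\,n^*$, where $$n^*=\Big\lfloor \frac{f(x_0)-\inf f}{\min\{\theta,1\}}\Big\rfloor+1,\qquad \theta=\min_{C\in\mathcal E}\min_{v\in C}\|v\|^2,$$ and $\mathcal E$ is the finite family of all sets $C=\mathrm{co}\{v_i: i\in S\}+w_j$ with $\emptyset\ne S\subseteq\{1,\dots,l\}$, $j\in J$, and $0\notin C$ ($\theta=+\infty$ if $\mathcal E=\emptyset$). -/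

import Mathlib

open scoped Pointwise

/-! ### Piecewise affine functions -/

/-- A polyhedral set: the intersection of a finite family of closed half-spaces. -/
def IsPolyhedral {d : ℕ} (Q : Set (EuclideanSpace ℝ (Fin d))) : Prop :=
  ∃ (m : ℕ) (c : Fin m → EuclideanSpace ℝ (Fin d)) (β : Fin m → ℝ),
    (∀ r, c r ≠ 0) ∧ Q = ⋂ r, {x | inner ℝ (c r) x ≤ β r}

/-- A polyhedral partition of `ℝ^d`: finitely many polyhedral sets with nonempty and mutually
disjoint interiors, covering the space. -/
structure IsPolyhedralPartition {d k : ℕ} (Q : Fin k → Set (EuclideanSpace ℝ (Fin d))) :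
    Prop where
  polyhedral : ∀ i, IsPolyhedral (Q i)
  cover : ⋃ i, Q i = Set.univ
  interior_nonempty : ∀ i, (interior (Q i)).Nonempty
  interior_disjoint : ∀ i j, i ≠ j → Disjoint (interior (Q i)) (interior (Q j))

/-- `f` is piecewise affine: its restriction to each member of some polyhedral partition of `ℝ^d`
is affine. -/
def IsPiecewiseAffine {d : ℕ} (f : EuclideanSpace ℝ (Fin d) → ℝ) : Prop :=
  ∃ (k : ℕ) (Q : Fin k → Set (EuclideanSpace ℝ (Fin d))), IsPolyhedralPartition Q ∧
    ∀ i, ∃ A : EuclideanSpace ℝ (Fin d) →ᵃ[ℝ] ℝ, ∀ x ∈ Q i, f x = A x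

/-! ### DC decompositions and global codifferentials -/

/-- The coefficients `(a_i, v_i)`, `i ∈ I`, and `(b_j, w_j)`, `j ∈ J`, of a function of the form
`max_i (a_i + ⟨v_i, x⟩) + min_j (b_j + ⟨w_j, x⟩)`, where `|I| = l` and `|J| = s`. -/
structure DCDecomposition (d l s : ℕ) where
  a : Fin l → ℝ
  v : Fin l → EuclideanSpace ℝ (Fin d)
  b : Fin s → ℝ
  w : Fin s → EuclideanSpace ℝ (Fin d)

namespace DCDecomposition

noncomputable section

variable {d l s : ℕ} [NeZero l] [NeZero s] (D : DCDecomposition d l s)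

/-- The convex part `max_i (a_i + ⟨v_i, x⟩)`. -/
def convexPart (x : EuclideanSpace ℝ (Fin d)) : ℝ :=
  Finset.univ.sup' Finset.univ_nonempty fun i : Fin l => D.a i + inner ℝ (D.v i) x

/-- The concave part `min_j (b_j + ⟨w_j, x⟩)`. -/
def concavePart (x : EuclideanSpace ℝ (Fin d)) : ℝ :=
  Finset.univ.inf' Finset.univ_nonempty fun j : Fin s => D.b j + inner ℝ (D.w j) x

/-- `D` is a DC decomposition of the function `f`. -/
def Represents (f : EuclideanSpace ℝ (Fin d) → ℝ) : Prop :=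
  ∀ x, f x = D.convexPart x + D.concavePart x

/-- The global hypodifferential at `x`, a polytope in `ℝ × ℝ^d` with the Euclidean norm. -/
def hypodiff (x : EuclideanSpace ℝ (Fin d)) : Set (WithLp 2 (ℝ × EuclideanSpace ℝ (Fin d))) :=
  convexHull ℝ (Set.range fun i : Fin l =>
    WithLp.toLp 2 (D.a i - D.convexPart x + inner ℝ (D.v i) x, D.v i))

/-- The point `z_j(x) = (b_j - min_k (b_k + ⟨w_k, x⟩) + ⟨w_j, x⟩, w_j)` of the global
hyperdifferential at `x`. -/
def z (x : EuclideanSpace ℝ (Fin d)) (j : Fin s) : WithLp 2 (ℝ × EuclideanSpace ℝ (Fin d)) :=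
  WithLp.toLp 2 (D.b j - D.concavePart x + inner ℝ (D.w j) x, D.w j)

theorem exists_leastNorm (x : EuclideanSpace ℝ (Fin d)) (j : Fin s) :
    ∃ p ∈ D.hypodiff x + {D.z x j}, ∀ q ∈ D.hypodiff x + {D.z x j}, ‖p‖ ≤ ‖q‖ := by
  have hc : IsCompact (D.hypodiff x + {D.z x j}) :=
    ((Set.finite_range _).isCompact_convexHull ℝ).add isCompact_singleton
  have hn : (D.hypodiff x + {D.z x j}).Nonempty :=
    ((Set.range_nonempty _).convexHull).add (Set.singleton_nonempty _)
  obtain ⟨p, hp, h⟩ := hc.exists_isMinOn hn continuous_norm.continuousOn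
  exact ⟨p, hp, fun q hq => h hq⟩

/-- The pair `(a_j(x), v_j(x))`: the (unique) point of least Euclidean norm in the polytope
`hypodiff x + z_j(x)`. -/
def proj (x : EuclideanSpace ℝ (Fin d)) (j : Fin s) : WithLp 2 (ℝ × EuclideanSpace ℝ (Fin d)) :=
  (D.exists_leastNorm x j).choose

theorem proj_mem (x : EuclideanSpace ℝ (Fin d)) (j : Fin s) :
    D.proj x j ∈ D.hypodiff x + {D.z x j} :=
  (D.exists_leastNorm x j).choose_spec.1

theorem norm_proj_le (x : EuclideanSpace ℝ (Fin d)) (j : Fin s)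
    {q : WithLp 2 (ℝ × EuclideanSpace ℝ (Fin d))} (hq : q ∈ D.hypodiff x + {D.z x j}) :
    ‖D.proj x j‖ ≤ ‖q‖ :=
  (D.exists_leastNorm x j).choose_spec.2 q hq

/-- The trial point `x + a_j(x)⁻¹ v_j(x)` (used only when `a_j(x) < 0`). -/
def trial (x : EuclideanSpace ℝ (Fin d)) (j : Fin s) : EuclideanSpace ℝ (Fin d) :=
  x + (D.proj x j).fst⁻¹ • (D.proj x j).snd

/-! ### The method of global codifferential descent -/

/-- The sequences `x` and `M` are produced by the method of global codifferential descent applied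
to `f` with the starting point `x₀`. Here `M n` is the set of indices that are still kept after the
discarding step of iteration `n`; the method stops at the first `n` with `M n = ∅`, and no
condition is imposed on the terms that follow. The selected index is an arbitrary minimizer of
`f (trial (x n) j)` over `j ∈ M n`. -/
structure IsRun (f : EuclideanSpace ℝ (Fin d) → ℝ) (x₀ : EuclideanSpace ℝ (Fin d))
    (x : ℕ → EuclideanSpace ℝ (Fin d)) (M : ℕ → Set (Fin s)) : Prop where
  start : x 0 = x₀
  discard_zero : M 0 = Set.univ \ {j | 0 ≤ (D.proj (x 0) j).fst}
  step : ∀ n, (M n).Nonempty →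
    ∃ j ∈ M n, (∀ i ∈ M n, f (D.trial (x n) j) ≤ f (D.trial (x n) i)) ∧
      x (n + 1) = D.trial (x n) j
  discard_succ : ∀ n, (M n).Nonempty →
    M (n + 1) = M n \ {j | 0 ≤ (D.proj (x (n + 1)) j).fst}

/-! ### The iteration bound -/

/-- The finite family of all sets `C = co {v_i | i ∈ S} + w_j`, with `S` a nonempty set of indices,
that do not contain the origin. -/
def gradientSets : Set (Set (EuclideanSpace ℝ (Fin d))) :=
  {C | (∃ S : Set (Fin l), S.Nonempty ∧ ∃ j : Fin s, C = convexHull ℝ (D.v '' S) + {D.w j}) ∧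
    (0 : EuclideanSpace ℝ (Fin d)) ∉ C}

/-- The number `min {θ, 1}`, where `θ` is the minimum of `‖v‖²` over all `v ∈ C ∈ gradientSets`
(`θ = +∞` if there are no such sets). -/
def minThetaOne : ℝ :=
  sInf (insert 1 {r : ℝ | ∃ C ∈ D.gradientSets, ∃ v ∈ C, r = ‖v‖ ^ 2})

/-- The number `n* = ⌊(f(x₀) - inf f) / min {θ, 1}⌋ + 1`. -/
def nStar (f : EuclideanSpace ℝ (Fin d) → ℝ) (x₀ : EuclideanSpace ℝ (Fin d)) : ℕ :=
  ⌊(f x₀ - ⨅ y, f y) / D.minThetaOne⌋₊ + 1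

end

end DCDecomposition

/-! A piecewise affine function is continuous and selects among finitely many affine functions,
hence is a max of mins of them. Differences of maxima of affine functions contain the affine
functions and are closed under max and min, which gives the representation. Write `f` as the minimum
of convex functions `branch j`. Relative to `x`, the points of `hypodiff x + z_j(x)` are affine
minorants of `branch j - f x`, and its spanning points attain the maximum. If the least-norm point
has first coordinate `≥ 0`, then `f x` is a lower bound of `branch j`
(`Represents.le_branch_of_nonneg`; boundedness below puts `0` among the convex combinations of
gradients). Otherwise the trial step either lowers `f` by `minThetaOne` or gives a value of `f`
below all of `branch j`, so that `j`, if it was the chosen index, is discarded next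
(`Represents.trial_decrease_or_minimizes`). Thus `|M| + ⌊(f - inf f) / minThetaOne⌋` drops at each
update. Since `f` never increases, lower bounds for discarded branches persist; once all are
discarded, the point is a global minimizer. Attainment of the minimum follows by running the method.
-/

/-! ### Lattice representation of piecewise affine functions -/

/-- A continuous function of one variable which at each point takes the value of one of finitely
many affine functions `t ↦ (1 - t) p_i + t q_i`, and vanishes at `0` and `1`: some of these affine
functions is nonpositive at `0` and nonnegative at `1`. -/
theorem exists_nonpos_nonneg_of_continuous_selection {ι : Type*} [Finite ι] {p q : ι → ℝ}
    {ψ : ℝ → ℝ} (hψ : Continuous ψ) (h0 : ψ 0 = 0) (h1 : ψ 1 = 0)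
    (hsel : ∀ t, ∃ i, ψ t = (1 - t) * p i + t * q i) : ∃ i, p i ≤ 0 ∧ 0 ≤ q i := by
  by_contra! hcon
  -- Near a zero of `ψ`, continuity allows only pieces that vanish there.
  have hact : ∀ t, ψ t = 0 → ∀ᶠ u in nhds t, ∃ i,
      ψ u = (1 - u) * p i + u * q i ∧ (1 - t) * p i + t * q i = 0 := by
    intro t ht
    have h : ∀ i, ∀ᶠ u in nhds t, ψ u = (1 - u) * p i + u * q i →
        (1 - t) * p i + t * q i = 0 := by
      intro i
      by_cases hi : (1 - t) * p i + t * q i = 0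
      · exact Filter.Eventually.of_forall fun _ _ => hi
      · have hc : ContinuousAt (fun u => ψ u - ((1 - u) * p i + u * q i)) t := by fun_prop
        have hne : ψ t - ((1 - t) * p i + t * q i) ≠ 0 := by
          rw [ht, zero_sub]; exact neg_ne_zero.2 hi
        filter_upwards [hc.eventually_ne hne] with u hu h
        exact absurd (sub_eq_zero.2 h) hu
    filter_upwards [Filter.eventually_all.2 h] with u hu
    obtain ⟨i, hi⟩ := hsel u
    exact ⟨i, hi, hu i hi⟩
  -- Under `hcon` such a piece strictly decreases, so `ψ` cannot cross zero upwards on `[0, 1]`; yet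
  -- just left of its zero at `1` it must be positive.
  have hslope : ∀ t, 0 ≤ t → t ≤ 1 → ∀ i, (1 - t) * p i + t * q i = 0 → q i - p i < 0 := by
    intro t ht0 ht1 i hi
    by_contra! hle
    rcases lt_or_ge 0 (p i) with hp | hp
    · nlinarith
    · have := hcon i hp
      nlinarith
  have hIcc : Set.Icc (0 : ℝ) 1 ⊆ {t | ψ t ≤ 0} := by
    refine IsClosed.Icc_subset_of_forall_exists_gt
      ((isClosed_le hψ continuous_const).inter isClosed_Icc) h0.le ?_
    rintro t ⟨ht, ht0, ht1⟩ y hy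
    have hev : ∀ᶠ u in nhdsWithin t (Set.Ioi t), ψ u ≤ 0 := by
      rcases lt_or_eq_of_le (show ψ t ≤ 0 from ht) with hlt | heq
      · exact nhdsWithin_le_nhds ((hψ.continuousAt.eventually_lt_const hlt).mono fun _ h => h.le)
      · filter_upwards [nhdsWithin_le_nhds (hact t heq), self_mem_nhdsWithin] with u hu htu
        obtain ⟨i, hi, hi0⟩ := hu
        have hs := hslope t ht0 ht1.le i hi0
        have htu' : t < u := htu
        nlinarith
    obtain ⟨u, hu, hmem⟩ := (hev.and (Ioc_mem_nhdsGT hy)).exists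
    exact ⟨u, hu, hmem⟩
  have hev : ∀ᶠ u in nhdsWithin (1 : ℝ) (Set.Iio 1), 0 < ψ u := by
    filter_upwards [nhdsWithin_le_nhds (hact 1 h1), self_mem_nhdsWithin] with u hu hlt
    obtain ⟨i, hi, hi0⟩ := hu
    have hs := hslope 1 zero_le_one le_rfl i hi0
    have hlt' : u < 1 := hlt
    nlinarith
  obtain ⟨u, hu, hmem⟩ := (hev.and (Ico_mem_nhdsLT (zero_lt_one' ℝ))).exists
  exact absurd (hIcc ⟨hmem.1, hmem.2.le⟩) (not_le.2 hu)

/-- Restrict to the line through `x` and `y` and subtract the chord of `f`, which reduces the claim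
to one variable. -/
theorem exists_affine_le_and_ge_of_continuous_selection {E ι : Type*} [NormedAddCommGroup E]
    [NormedSpace ℝ E] [Finite ι] {f : E → ℝ} (hf : Continuous f) (A : ι → E →ᵃ[ℝ] ℝ)
    (hsel : ∀ x, ∃ i, f x = A i x) (x y : E) : ∃ i, A i x ≤ f x ∧ f y ≤ A i y := by
  have hmap : ∀ i (t : ℝ), A i (AffineMap.lineMap x y t) = (1 - t) * A i x + t * A i y := by
    intro i t
    rw [AffineMap.apply_lineMap, AffineMap.lineMap_apply_ring']
    ring
  obtain ⟨i, h1, h2⟩ := exists_nonpos_nonneg_of_continuous_selection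
    (p := fun i => A i x - f x) (q := fun i => A i y - f y)
    (ψ := fun t => f (AffineMap.lineMap x y t) - ((1 - t) * f x + t * f y))
    (by
      have : Continuous (AffineMap.lineMap x y : ℝ → E) := AffineMap.lineMap_continuous
      fun_prop)
    (by simp) (by simp) (by
      intro t
      obtain ⟨i, hi⟩ := hsel (AffineMap.lineMap x y t)
      refine ⟨i, ?_⟩
      simp only [hi, hmap]
      ring)
  exact ⟨i, by linarith, by linarith⟩

/-- A continuous selection of finitely many affine functions is a maximum of minima of these
functions. -/
theorem exists_sup'_inf'_of_continuous_selection {E ι : Type*} [NormedAddCommGroup E]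
    [NormedSpace ℝ E] [Finite ι] {f : E → ℝ} (hf : Continuous f) (A : ι → E →ᵃ[ℝ] ℝ)
    (hsel : ∀ x, ∃ i, f x = A i x) :
    ∃ (T : Finset (E → ℝ)) (hT : T.Nonempty),
      (∀ h ∈ T, ∃ (S : Finset ι) (hS : S.Nonempty), h = S.inf' hS fun i => (A i : E → ℝ)) ∧
      f = T.sup' hT id := by
  classical
  have := Fintype.ofFinite ι
  -- The minimum over `S y` is at least `f` at `y`, and at most `f` everywhere by the preceding
  -- lemma. Only finitely many subsets `S y` occur.
  let S : E → Finset ι := fun y => {i | f y ≤ A i y}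
  have hS : ∀ y, (S y).Nonempty := fun y => by
    obtain ⟨i, hi⟩ := hsel y
    exact ⟨i, by simp [S, hi]⟩
  let h : E → E → ℝ := fun y => (S y).inf' (hS y) fun i => (A i : E → ℝ)
  have hfin : (Set.range h).Finite := by
    refine (Set.finite_range fun S : {S : Finset ι // S.Nonempty} =>
      S.1.inf' S.2 fun i => (A i : E → ℝ)).subset ?_
    rintro _ ⟨y, rfl⟩
    exact ⟨⟨S y, hS y⟩, rfl⟩
  have hT : hfin.toFinset.Nonempty := 
    ⟨h 0, hfin.mem_toFinset.2 ⟨0, rfl⟩⟩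
  refine ⟨hfin.toFinset, hT, ?_, le_antisymm ?_ ?_⟩
  · intro g hg
    obtain ⟨y, rfl⟩ := hfin.mem_toFinset.1 hg
    exact ⟨S y, hS y, rfl⟩
  · intro y
    have h1 : f y ≤ h y y := by
      simp only [h, Finset.inf'_apply]
      exact Finset.le_inf' _ _ fun i hi => by simpa [S] using hi
    exact h1.trans (Finset.le_sup' id (hfin.mem_toFinset.2 ⟨y, rfl⟩) y)
  · refine Finset.sup'_le _ _ fun g hg => ?_
    obtain ⟨y, rfl⟩ := hfin.mem_toFinset.1 hg
    intro x
    obtain ⟨i, hi, hi'⟩ := exists_affine_le_and_ge_of_continuous_selection hf A hsel x y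
    simp only [h, id, Finset.inf'_apply]
    exact (Finset.inf'_le _ (by simpa [S] using hi')).trans hi

/-! ### Differences of maxima of affine functions -/

/-- `g` is the maximum of finitely many affine functions `x ↦ a + ⟨v, x⟩`. -/
def IsMaxAffine {E : Type*} [NormedAddCommGroup E] [InnerProductSpace ℝ E] (g : E → ℝ) : Prop :=
  ∃ T : Finset (ℝ × E), ∀ x, (∀ p ∈ T, p.1 + inner ℝ p.2 x ≤ g x) ∧
    ∃ p ∈ T, g x = p.1 + inner ℝ p.2 x

/-- `f` is a difference of two maxima of finitely many affine functions. -/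
def IsDiffMaxAffine {E : Type*} [NormedAddCommGroup E] [InnerProductSpace ℝ E]
    (f : E → ℝ) : Prop :=
  ∃ g h : E → ℝ, IsMaxAffine g ∧ IsMaxAffine h ∧ f = g - h

section

variable {E : Type*} [NormedAddCommGroup E] [InnerProductSpace ℝ E]

theorem isMaxAffine_affine (a : ℝ) (v : E) : IsMaxAffine fun x => a + inner ℝ v x :=
  ⟨{(a, v)}, fun x => by simp⟩

theorem IsMaxAffine.sup {g h : E → ℝ} (hg : IsMaxAffine g) (hh : IsMaxAffine h) :
    IsMaxAffine (g ⊔ h) := by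
  classical
  obtain ⟨T, hT⟩ := hg
  obtain ⟨S, hS⟩ := hh
  refine ⟨T ∪ S, fun x => ⟨fun p hp => ?_, ?_⟩⟩
  · rcases Finset.mem_union.1 hp with hp | hp
    · exact ((hT x).1 p hp).trans le_sup_left
    · exact ((hS x).1 p hp).trans le_sup_right
  · obtain ⟨p, hp, hpx⟩ := (hT x).2
    obtain ⟨q, hq, hqx⟩ := (hS x).2
    rcases le_total (g x) (h x) with hle | hle
    · exact ⟨q, Finset.mem_union_right _ hq, by rw [Pi.sup_apply, sup_eq_right.2 hle, hqx]⟩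
    · exact ⟨p, Finset.mem_union_left _ hp, by rw [Pi.sup_apply, sup_eq_left.2 hle, hpx]⟩

theorem IsMaxAffine.add {g h : E → ℝ} (hg : IsMaxAffine g) (hh : IsMaxAffine h) :
    IsMaxAffine (g + h) := by
  classical
  obtain ⟨T, hT⟩ := hg
  obtain ⟨S, hS⟩ := hh
  refine ⟨T + S, fun x => ⟨fun r hr => ?_, ?_⟩⟩
  · obtain ⟨p, hp, q, hq, rfl⟩ := Finset.mem_add.1 hr
    have h1 := (hT x).1 p hp
    have h2 := (hS x).1 q hq
    simp only [Prod.fst_add, Prod.snd_add, inner_add_left, Pi.add_apply]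
    linarith
  · obtain ⟨p, hp, hpx⟩ := (hT x).2
    obtain ⟨q, hq, hqx⟩ := (hS x).2
    refine ⟨p + q, Finset.add_mem_add hp hq, ?_⟩
    simp only [Prod.fst_add, Prod.snd_add, inner_add_left, Pi.add_apply, hpx, hqx]
    ring

theorem IsDiffMaxAffine.neg {f : E → ℝ} (hf : IsDiffMaxAffine f) : IsDiffMaxAffine (-f) := by
  obtain ⟨g, h, hg, hh, rfl⟩ := hf
  exact ⟨h, g, hh, hg, neg_sub _ _⟩

theorem IsDiffMaxAffine.sup {f₁ f₂ : E → ℝ} (h₁ : IsDiffMaxAffine f₁) (h₂ : IsDiffMaxAffine f₂) :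
    IsDiffMaxAffine (f₁ ⊔ f₂) := by
  obtain ⟨g₁, k₁, hg₁, hk₁, rfl⟩ := h₁
  obtain ⟨g₂, k₂, hg₂, hk₂, rfl⟩ := h₂
  -- Both differences are written with the common subtrahend `k₁ + k₂`.
  refine ⟨(g₁ + k₂) ⊔ (g₂ + k₁), k₁ + k₂, (hg₁.add hk₂).sup (hg₂.add hk₁), hk₁.add hk₂, ?_⟩
  ext x
  simp only [Pi.sup_apply, Pi.sub_apply, Pi.add_apply]
  rw [← max_sub_sub_right]
  congr 1 <;> ring

theorem IsDiffMaxAffine.inf {f₁ f₂ : E → ℝ} (h₁ : IsDiffMaxAffine f₁) (h₂ : IsDiffMaxAffine f₂) :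
    IsDiffMaxAffine (f₁ ⊓ f₂) := by
  have h := (h₁.neg.sup h₂.neg).neg
  rwa [neg_sup, neg_neg, neg_neg] at h

theorem isDiffMaxAffine_affineMap [FiniteDimensional ℝ E] (A : E →ᵃ[ℝ] ℝ) :
    IsDiffMaxAffine (A : E → ℝ) := by
  let L : E →L[ℝ] ℝ := LinearMap.toContinuousLinearMap A.linear
  refine ⟨_, _, isMaxAffine_affine (A 0) ((InnerProductSpace.toDual ℝ E).symm L),
    isMaxAffine_affine 0 0, ?_⟩
  ext x
  simp only [Pi.sub_apply, InnerProductSpace.toDual_symm_apply, inner_zero_left, add_zero, sub_zero]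
  have h := A.map_vadd 0 x
  simp only [vadd_eq_add, add_zero] at h
  rw [h, add_comm]
  rfl

/-- A maximum of finitely many affine functions as an indexed maximum. -/
theorem IsMaxAffine.exists_sup' {g : E → ℝ} (hg : IsMaxAffine g) :
    ∃ (l : ℕ) (_ : NeZero l) (a : Fin l → ℝ) (v : Fin l → E), ∀ x,
      g x = Finset.univ.sup' Finset.univ_nonempty fun i => a i + inner ℝ (v i) x := by
  obtain ⟨T, hT⟩ := hg
  have hne : NeZero T.card := ⟨by
    obtain ⟨p, hp, -⟩ := (hT 0).2
    exact Finset.card_ne_zero_of_mem hp⟩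
  refine ⟨T.card, hne, fun i => (T.equivFin.symm i).1.1, fun i => (T.equivFin.symm i).1.2,
    fun x => le_antisymm ?_ ?_⟩
  · obtain ⟨p, hp, hpx⟩ := (hT x).2
    refine hpx.le.trans ?_
    have := Finset.le_sup' (fun i => (T.equivFin.symm i).1.1 + inner ℝ (T.equivFin.symm i).1.2 x)
      (Finset.mem_univ (T.equivFin ⟨p, hp⟩))
    simpa only [Equiv.symm_apply_apply] using this
  · exact Finset.sup'_le _ _ fun i _ => (hT x).1 _ (T.equivFin.symm i).2

end

theorem IsPolyhedral.isClosed {d : ℕ} {Q : Set (EuclideanSpace ℝ (Fin d))} (hQ : IsPolyhedral Q) :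
    IsClosed Q := by
  obtain ⟨m, c, β, -, rfl⟩ := hQ
  exact isClosed_iInter fun r => isClosed_le (by fun_prop) continuous_const

theorem IsPiecewiseAffine.isDiffMaxAffine {d : ℕ} {f : EuclideanSpace ℝ (Fin d) → ℝ}
    (hf : IsPiecewiseAffine f) : IsDiffMaxAffine f := by
  obtain ⟨k, Q, hQ, hA⟩ := hf
  choose A hA using hA
  have hcont : Continuous f :=
    (locallyFinite_of_finite Q).continuous hQ.cover (fun i => (hQ.polyhedral i).isClosed)
      fun i => (A i).continuous_of_finiteDimensional.continuousOn.congr (hA i)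
  have hsel : ∀ x, ∃ i, f x = A i x := fun x => by
    obtain ⟨i, hi⟩ := Set.mem_iUnion.1 (hQ.cover ▸ Set.mem_univ x)
    exact ⟨i, hA i x hi⟩
  obtain ⟨T, hT, hmem, rfl⟩ := exists_sup'_inf'_of_continuous_selection hcont A hsel
  refine Finset.sup'_induction hT id (fun _ h₁ _ h₂ => h₁.sup h₂) fun h hh => ?_
  obtain ⟨S, hS, rfl⟩ := hmem h hh
  exact Finset.inf'_induction hS _ (fun _ h₁ _ h₂ => h₁.inf h₂)
    fun i _ => isDiffMaxAffine_affineMap (A i)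

theorem IsPiecewiseAffine.exists_represents {d : ℕ} {f : EuclideanSpace ℝ (Fin d) → ℝ}
    (hf : IsPiecewiseAffine f) :
    ∃ (l s : ℕ) (_ : NeZero l) (_ : NeZero s) (D : DCDecomposition d l s), D.Represents f := by
  obtain ⟨g, h, hg, hh, rfl⟩ := hf.isDiffMaxAffine
  obtain ⟨l, hl, a, v, hg⟩ := hg.exists_sup'
  obtain ⟨s, hs, b, w, hh⟩ := hh.exists_sup'
  refine ⟨l, s, hl, hs, ⟨a, v, fun j => -b j, fun j => -w j⟩, fun x => ?_⟩
  simp only [DCDecomposition.convexPart, DCDecomposition.concavePart, Pi.sub_apply, hg, hh,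
    sub_eq_add_neg]
  congr 1
  refine le_antisymm (Finset.le_inf' _ _ fun j _ => ?_) ?_
  · have := Finset.le_sup' (fun j => b j + inner ℝ (w j) x) (Finset.mem_univ j)
    simp only [inner_neg_left]
    linarith
  · obtain ⟨j, -, hj⟩ := Finset.exists_mem_eq_sup' Finset.univ_nonempty
      fun j => b j + inner ℝ (w j) x
    refine (Finset.inf'_le _ (Finset.mem_univ j)).trans ?_
    rw [hj, inner_neg_left]
    linarith


/-! ### Faces and points of least norm of convex sets -/

/-- In a convex combination equal to `p`, the nonnegative excesses of `φ` over `φ p` average to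
zero, so only points with zero excess carry weight. -/
theorem mem_convexHull_face {E : Type*} [AddCommGroup E] [Module ℝ E] (φ : E →ₗ[ℝ] ℝ) {s : Set E}
    {p : E} (hp : p ∈ convexHull ℝ s) (h : ∀ x ∈ s, φ p ≤ φ x) :
    p ∈ convexHull ℝ {x ∈ s | φ x = φ p} := by
  classical
  obtain ⟨ι, _, w, z, hw, hw1, hz, hsum⟩ := mem_convexHull_iff_exists_fintype.1 hp
  have hzero : ∑ k, w k * (φ (z k) - φ p) = 0 := by
    have : φ p = ∑ k, w k * φ (z k) := by
      conv_lhs => rw [← hsum]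
      simp
    simp only [mul_sub, Finset.sum_sub_distrib, ← Finset.sum_mul, hw1, ← this]
    ring
  have hterm : ∀ k, w k * (φ (z k) - φ p) = 0 := fun k =>
    (Finset.sum_eq_zero_iff_of_nonneg fun k _ =>
      mul_nonneg (hw k) (sub_nonneg.2 (h _ (hz k)))).1 hzero k (Finset.mem_univ k)
  have hsum' : ∑ k with w k ≠ 0, w k • z k = p := by
    rw [← hsum]
    exact Finset.sum_filter_of_ne fun k _ hk hk0 => hk (by rw [hk0, zero_smul])
  have hw1' : ∑ k with w k ≠ 0, w k = 1 := by
    rw [← hw1]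
    exact Finset.sum_filter_of_ne fun k _ hk => hk
  rw [← hsum']
  refine (convex_convexHull ℝ _).sum_mem (fun k _ => hw k) hw1' fun k hk => ?_
  refine subset_convexHull ℝ _ ⟨hz k, ?_⟩
  rw [hsum']
  exact sub_eq_zero.1 ((mul_eq_zero.1 (hterm k)).resolve_left (Finset.mem_filter.1 hk).2)

theorem norm_sq_le_inner_of_forall_norm_le {F : Type*} [NormedAddCommGroup F]
    [InnerProductSpace ℝ F] {K : Set F} (hK : Convex ℝ K) {p : F} (hp : p ∈ K)
    (hmin : ∀ q ∈ K, ‖p‖ ≤ ‖q‖) {q : F} (hq : q ∈ K) : ‖p‖ ^ 2 ≤ inner ℝ p q := by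
  have : Nonempty K := ⟨⟨p, hp⟩⟩
  have h : ‖(0 : F) - p‖ = ⨅ w : K, ‖(0 : F) - w‖ := by
    refine le_antisymm (le_ciInf fun w => ?_) (ciInf_le ⟨0, ?_⟩ (⟨p, hp⟩ : K))
    · simpa using hmin w w.2
    · rintro _ ⟨w, rfl⟩
      exact norm_nonneg _
  have := (norm_eq_iInf_iff_real_inner_le_zero hK hp).1 h q hq
  rw [zero_sub, inner_neg_left, inner_sub_right, real_inner_self_eq_norm_sq] at this
  linarith

namespace DCDecomposition

noncomputable section

variable {d l s : ℕ}

section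

variable (D : DCDecomposition d l s)

theorem convexHull_image_v_add_w (S : Set (Fin l)) (j : Fin s) :
    convexHull ℝ (D.v '' S) + {D.w j} = convexHull ℝ ((fun i => D.v i + D.w j) '' S) := by
  rw [← convexHull_singleton (𝕜 := ℝ) (D.w j), ← convexHull_add, Set.add_singleton,
    Set.image_image]

theorem isClosed_convexHull_image_v_add_w (S : Set (Fin l)) (j : Fin s) :
    IsClosed (convexHull ℝ (D.v '' S) + {D.w j}) := by
  rw [convexHull_image_v_add_w]
  exact (S.toFinite.image _).isClosed_convexHull ℝ

theorem finite_gradientSets : D.gradientSets.Finite := by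
  refine (Set.finite_range fun p : Set (Fin l) × Fin s =>
    convexHull ℝ (D.v '' p.1) + {D.w p.2}).subset ?_
  rintro C ⟨⟨S, -, j, rfl⟩, -⟩
  exact ⟨(S, j), rfl⟩

/-- A finite union of closed sets missing `0` misses a ball around `0`. -/
theorem minThetaOne_pos : 0 < D.minThetaOne := by
  have hcl : IsClosed (⋃ C ∈ D.gradientSets, C) := by
    refine D.finite_gradientSets.isClosed_biUnion ?_
    rintro C ⟨⟨S, -, j, rfl⟩, -⟩
    exact D.isClosed_convexHull_image_v_add_w S j
  have h0 : (0 : EuclideanSpace ℝ (Fin d)) ∈ (⋃ C ∈ D.gradientSets, C)ᶜ := by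
    simp only [Set.mem_compl_iff, Set.mem_iUnion, not_exists]
    exact fun C hC => hC.2
  obtain ⟨ε, hε, hball⟩ := Metric.isOpen_iff.1 hcl.isOpen_compl 0 h0
  refine lt_of_lt_of_le (lt_min one_pos (pow_pos hε 2)) (le_csInf (Set.insert_nonempty _ _) ?_)
  rintro r (rfl | ⟨C, hC, v, hv, rfl⟩)
  · exact min_le_left _ _
  · refine (min_le_right _ _).trans (pow_le_pow_left₀ hε.le ?_ 2)
    by_contra! hlt
    exact hball (mem_ball_zero_iff.2 hlt) (Set.mem_biUnion hC hv)

theorem bddBelow_insert_one_normSq :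
    BddBelow (insert 1 {r : ℝ | ∃ C ∈ D.gradientSets, ∃ v ∈ C, r = ‖v‖ ^ 2}) := by
  refine ⟨0, ?_⟩
  rintro r (rfl | ⟨C, -, v, -, rfl⟩) <;> positivity

theorem minThetaOne_le_one : D.minThetaOne ≤ 1 :=
  csInf_le D.bddBelow_insert_one_normSq (Set.mem_insert _ _)

theorem minThetaOne_le_norm_sq {C : Set (EuclideanSpace ℝ (Fin d))} (hC : C ∈ D.gradientSets)
    {v : EuclideanSpace ℝ (Fin d)} (hv : v ∈ C) : D.minThetaOne ≤ ‖v‖ ^ 2 :=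
  csInf_le D.bddBelow_insert_one_normSq (Or.inr ⟨C, hC, v, hv, rfl⟩)

end

variable [NeZero l] (D : DCDecomposition d l s)

/-! ### The convex branches of the objective function -/

/-- The convex function `max_i (a_i + ⟨v_i, x⟩) + (b_j + ⟨w_j, x⟩)`. -/
def branch (j : Fin s) (y : EuclideanSpace ℝ (Fin d)) : ℝ :=
  D.convexPart y + (D.b j + inner ℝ (D.w j) y)

theorem le_convexPart (i : Fin l) (y : EuclideanSpace ℝ (Fin d)) :
    D.a i + inner ℝ (D.v i) y ≤ D.convexPart y :=
  Finset.le_sup' (fun i => D.a i + inner ℝ (D.v i) y) (Finset.mem_univ i)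

theorem exists_convexPart_eq (y : EuclideanSpace ℝ (Fin d)) :
    ∃ i, D.convexPart y = D.a i + inner ℝ (D.v i) y := by
  obtain ⟨i, -, hi⟩ := Finset.exists_mem_eq_sup' Finset.univ_nonempty
    fun i : Fin l => D.a i + inner ℝ (D.v i) y
  exact ⟨i, hi⟩

variable {D}

/-- The convex hull of the gradients of a convex branch that is bounded below contains `0`. -/
theorem zero_mem_of_bddBelow_branch {j : Fin s} (hb : BddBelow (Set.range (D.branch j))) :
    (0 : EuclideanSpace ℝ (Fin d)) ∈ convexHull ℝ (D.v '' Set.univ) + {D.w j} := by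
  rw [convexHull_image_v_add_w]
  set K := convexHull ℝ ((fun i => D.v i + D.w j) '' Set.univ) with hK
  have hmem : ∀ i, D.v i + D.w j ∈ K := fun i =>
    subset_convexHull ℝ _ (Set.mem_image_of_mem _ (Set.mem_univ i))
  obtain ⟨p, hp, hmin⟩ := ((Set.finite_univ.image _).isCompact_convexHull ℝ :
    IsCompact K).exists_isMinOn ⟨_, hmem 0⟩ continuous_norm.continuousOn
  by_contra h0
  have hpos : 0 < ‖p‖ ^ 2 := by
    have : p ≠ 0 := fun h => h0 (h ▸ hp)
    positivity
  obtain ⟨c, hc⟩ := hb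
  -- Along `-t • p` every affine piece of the branch falls at rate at least `‖p‖ ^ 2`.
  have hle : ∀ t : ℝ, 0 ≤ t → c ≤ D.convexPart 0 + D.b j - t * ‖p‖ ^ 2 := by
    intro t ht
    refine (hc ⟨-t • p, rfl⟩).trans ?_
    obtain ⟨i, hi⟩ := D.exists_convexPart_eq (-t • p)
    have h1 := D.le_convexPart i 0
    have h2 := norm_sq_le_inner_of_forall_norm_le (convex_convexHull ℝ _) hp
      (fun q hq => hmin hq) (hmem i)
    rw [branch, hi]
    rw [inner_zero_right] at h1
    rw [real_inner_comm, inner_add_left] at h2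
    rw [inner_smul_right, inner_smul_right]
    nlinarith
  have h1 := hle ((|D.convexPart 0 + D.b j - c| + 1) / ‖p‖ ^ 2) (by positivity)
  rw [div_mul_cancel₀ _ hpos.ne'] at h1
  linarith [le_abs_self (D.convexPart 0 + D.b j - c)]

variable [NeZero s] {f : EuclideanSpace ℝ (Fin d) → ℝ}

theorem Represents.le_branch (hf : D.Represents f) (j : Fin s) (y : EuclideanSpace ℝ (Fin d)) :
    f y ≤ D.branch j y := by
  have : D.concavePart y ≤ D.b j + inner ℝ (D.w j) y :=
    Finset.inf'_le (fun j => D.b j + inner ℝ (D.w j) y) (Finset.mem_univ j)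
  rw [hf y, branch]
  linarith

theorem Represents.exists_eq_branch (hf : D.Represents f) (y : EuclideanSpace ℝ (Fin d)) :
    ∃ j, f y = D.branch j y := by
  obtain ⟨j, -, hj⟩ := Finset.exists_mem_eq_inf' Finset.univ_nonempty
    fun j : Fin s => D.b j + inner ℝ (D.w j) y
  exact ⟨j, by rw [hf y, branch, concavePart, hj]⟩

/-! ### The polytopes in the codifferential -/

variable (D)

/-- The points that span the polytope `hypodiff x + z_j(x)`. -/
def vertex (x : EuclideanSpace ℝ (Fin d)) (j : Fin s) (i : Fin l) :
    WithLp 2 (ℝ × EuclideanSpace ℝ (Fin d)) :=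
  WithLp.toLp 2 (D.a i - D.convexPart x + inner ℝ (D.v i) x, D.v i) + D.z x j

theorem hypodiff_add_z (x : EuclideanSpace ℝ (Fin d)) (j : Fin s) :
    D.hypodiff x + {D.z x j} = convexHull ℝ (Set.range (D.vertex x j)) := by
  rw [hypodiff, ← convexHull_singleton (𝕜 := ℝ) (D.z x j), ← convexHull_add, Set.add_singleton,
    ← Set.range_comp]
  rfl

theorem vertex_snd (x : EuclideanSpace ℝ (Fin d)) (j : Fin s) (i : Fin l) :
    (D.vertex x j i).snd = D.v i + D.w j := rfl

theorem vertex_fst (x : EuclideanSpace ℝ (Fin d)) (j : Fin s) (i : Fin l) :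
    (D.vertex x j i).fst = D.a i - D.convexPart x + inner ℝ (D.v i) x +
      (D.b j - D.concavePart x + inner ℝ (D.w j) x) := rfl

variable {D}

/-- Each spanning point encodes one affine piece of `branch j - f x`, expanded around `x`. -/
theorem Represents.vertex_eval (hf : D.Represents f) (x y : EuclideanSpace ℝ (Fin d)) (j : Fin s)
    (i : Fin l) : (D.vertex x j i).fst + inner ℝ (D.vertex x j i).snd (y - x) =
      D.a i + inner ℝ (D.v i) y + (D.b j + inner ℝ (D.w j) y) - f x := by
  rw [hf x, vertex_fst, vertex_snd]
  simp only [inner_add_left, inner_sub_right]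
  ring

theorem Represents.eval_le_branch_sub (hf : D.Represents f) (x y : EuclideanSpace ℝ (Fin d))
    (j : Fin s) {q : WithLp 2 (ℝ × EuclideanSpace ℝ (Fin d))}
    (hq : q ∈ convexHull ℝ (Set.range (D.vertex x j))) :
    q.fst + inner ℝ q.snd (y - x) ≤ D.branch j y - f x := by
  have hconv : Convex ℝ {q : WithLp 2 (ℝ × EuclideanSpace ℝ (Fin d)) |
      q.fst + inner ℝ q.snd (y - x) ≤ D.branch j y - f x} := by
    refine convex_halfSpace_le ⟨fun p q => ?_, fun c p => ?_⟩ _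
    · simp only [WithLp.add_fst, WithLp.add_snd, inner_add_left]
      ring
    · simp only [WithLp.smul_fst, WithLp.smul_snd, real_inner_smul_left, smul_eq_mul]
      ring
  refine convexHull_min ?_ hconv hq
  rintro _ ⟨i, rfl⟩
  rw [Set.mem_ofPred, hf.vertex_eval, branch]
  linarith [D.le_convexPart i y]

theorem Represents.exists_branch_sub_eq (hf : D.Represents f) (x y : EuclideanSpace ℝ (Fin d))
    (j : Fin s) :
    ∃ i, D.branch j y - f x = (D.vertex x j i).fst + inner ℝ (D.vertex x j i).snd (y - x) := by
  obtain ⟨i, hi⟩ := D.exists_convexPart_eq y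
  exact ⟨i, by rw [hf.vertex_eval, branch, hi]⟩

theorem exists_snd_eq_zero (x : EuclideanSpace ℝ (Fin d)) {j : Fin s} {S : Set (Fin l)}
    (h : (0 : EuclideanSpace ℝ (Fin d)) ∈ convexHull ℝ (D.v '' S) + {D.w j}) :
    ∃ q ∈ convexHull ℝ (D.vertex x j '' S), q.snd = 0 := by
  rw [convexHull_image_v_add_w] at h
  have himg : (fun i => D.v i + D.w j) '' S =
      WithLp.sndₗ 2 ℝ ℝ (EuclideanSpace ℝ (Fin d)) '' (D.vertex x j '' S) := by
    rw [Set.image_image]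
    rfl
  rw [himg, ← LinearMap.image_convexHull] at h
  exact h

variable (D)

theorem norm_sq_proj (x : EuclideanSpace ℝ (Fin d)) (j : Fin s) :
    ‖D.proj x j‖ ^ 2 = (D.proj x j).fst ^ 2 + ‖(D.proj x j).snd‖ ^ 2 := by
  rw [WithLp.prod_norm_sq_eq_of_L2, Real.norm_eq_abs, sq_abs]

theorem norm_sq_proj_le_inner (x : EuclideanSpace ℝ (Fin d)) (j : Fin s)
    {q : WithLp 2 (ℝ × EuclideanSpace ℝ (Fin d))}
    (hq : q ∈ convexHull ℝ (Set.range (D.vertex x j))) :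
    ‖D.proj x j‖ ^ 2 ≤ inner ℝ (D.proj x j) q := by
  rw [← hypodiff_add_z] at hq
  refine norm_sq_le_inner_of_forall_norm_le ?_ (D.proj_mem x j) (fun q => D.norm_proj_le x j) hq
  rw [hypodiff_add_z]
  exact convex_convexHull ℝ _

theorem inner_proj (x : EuclideanSpace ℝ (Fin d)) (j : Fin s)
    (q : WithLp 2 (ℝ × EuclideanSpace ℝ (Fin d))) :
    inner ℝ (D.proj x j) q =
      (D.proj x j).fst * q.fst + inner ℝ (D.proj x j).snd q.snd := by
  rw [WithLp.prod_inner_apply, mul_comm]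
  rfl

end

end DCDecomposition

namespace DCDecomposition

noncomputable section

variable {d l s : ℕ} [NeZero l] [NeZero s] {D : DCDecomposition d l s}
  {f : EuclideanSpace ℝ (Fin d) → ℝ}

/-! ### One step of the method -/

theorem Represents.zero_mem (hf : D.Represents f) (hb : BddBelow (Set.range f)) (j : Fin s) :
    (0 : EuclideanSpace ℝ (Fin d)) ∈ convexHull ℝ (D.v '' Set.univ) + {D.w j} := by
  obtain ⟨c, hc⟩ := hb
  refine zero_mem_of_bddBelow_branch ⟨c, ?_⟩
  rintro _ ⟨y, rfl⟩
  exact (hc ⟨y, rfl⟩).trans (hf.le_branch j y)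

/-- With `p` the least-norm point and `a < 0` its first coordinate, the piece `q` evaluated at the
trial point is `⟨p, q⟩ / a`, at most `‖p‖ ^ 2 / a`. -/
theorem Represents.branch_trial_le (hf : D.Represents f) {x : EuclideanSpace ℝ (Fin d)}
    {j : Fin s} (ha : (D.proj x j).fst < 0) :
    D.branch j (D.trial x j) ≤
      f x + (D.proj x j).fst + ‖(D.proj x j).snd‖ ^ 2 / (D.proj x j).fst := by
  obtain ⟨i, hi⟩ := hf.exists_branch_sub_eq x (D.trial x j) j
  have h := D.norm_sq_proj_le_inner x j (subset_convexHull ℝ _ ⟨i, rfl⟩)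
  rw [D.norm_sq_proj, D.inner_proj] at h
  rw [trial, add_sub_cancel_left, inner_smul_right, real_inner_comm] at hi
  have hne := ha.ne
  set a := (D.proj x j).fst
  set q := D.vertex x j i
  have h' : q.fst + a⁻¹ * inner ℝ (D.proj x j).snd q.snd ≤
      a + ‖(D.proj x j).snd‖ ^ 2 / a := by
    have e1 : q.fst + a⁻¹ * inner ℝ (D.proj x j).snd q.snd =
        (a * q.fst + inner ℝ (D.proj x j).snd q.snd) / a := by
      field_simp
    have e2 : a + ‖(D.proj x j).snd‖ ^ 2 / a = (a ^ 2 + ‖(D.proj x j).snd‖ ^ 2) / a := by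
      field_simp
    rw [e1, e2]
    exact div_le_div_of_nonpos_of_le ha.le h
  rw [trial]
  linarith

theorem Represents.le_branch_of_nonneg (hf : D.Represents f) (hb : BddBelow (Set.range f))
    {x : EuclideanSpace ℝ (Fin d)} {j : Fin s} (ha : 0 ≤ (D.proj x j).fst)
    (y : EuclideanSpace ℝ (Fin d)) : f x ≤ D.branch j y := by
  obtain ⟨q, hq, hq0⟩ := exists_snd_eq_zero x (hf.zero_mem hb j)
  rw [Set.image_univ] at hq
  have h1 := D.norm_sq_proj_le_inner x j hq
  have h2 := hf.eval_le_branch_sub x y j hq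
  rw [D.norm_sq_proj, D.inner_proj, hq0, inner_zero_right, add_zero] at h1
  rw [hq0, inner_zero_left, add_zero] at h2
  -- If the first coordinate is `0`, then `h1` forces the least-norm point itself to be `0`, a
  -- minorant; if positive, `h1` makes `q.fst` nonnegative.
  rcases ha.eq_or_lt with h0 | hpos
  · have hp : D.proj x j ∈ convexHull ℝ (Set.range (D.vertex x j)) :=
      D.hypodiff_add_z x j ▸ D.proj_mem x j
    have hsnd : (D.proj x j).snd = 0 := by
      rw [← h0] at h1
      have : ‖(D.proj x j).snd‖ ^ 2 = 0 := le_antisymm (by linarith) (sq_nonneg _)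
      simpa using this
    have h3 := hf.eval_le_branch_sub x y j hp
    rw [hsnd, inner_zero_left, add_zero] at h3
    linarith
  · have : 0 ≤ q.fst := nonneg_of_mul_nonneg_right (by nlinarith [sq_nonneg ‖(D.proj x j).snd‖]) hpos
    linarith

theorem Represents.nonneg_of_le_branch (hf : D.Represents f) {x : EuclideanSpace ℝ (Fin d)}
    {j : Fin s} (h : ∀ y, f x ≤ D.branch j y) : 0 ≤ (D.proj x j).fst := by
  by_contra! ha
  have h1 := hf.branch_trial_le ha
  have h2 := h (D.trial x j)
  have h3 := div_nonpos_of_nonneg_of_nonpos (sq_nonneg ‖(D.proj x j).snd‖) ha.le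
  linarith

theorem Represents.trial_decrease_or_minimizes (hf : D.Represents f)
    {x : EuclideanSpace ℝ (Fin d)} {j : Fin s} (ha : (D.proj x j).fst < 0) :
    f (D.trial x j) ≤ f x - D.minThetaOne ∨ ∀ y, f (D.trial x j) ≤ D.branch j y := by
  have hle := (hf.le_branch j _).trans (hf.branch_trial_le ha)
  set p := D.proj x j with hpdef
  have hp : p ∈ convexHull ℝ (Set.range (D.vertex x j)) :=
    D.hypodiff_add_z x j ▸ D.proj_mem x j
  have hpp : inner ℝ p p = ‖p‖ ^ 2 := real_inner_self_eq_norm_sq p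
  -- The face where `⟨p, ·⟩` is minimal contains `p`; its gradients either have `0` in their hull or
  -- form a member of `gradientSets`.
  have hface := mem_convexHull_face (innerₗ _ p) hp fun q hq => by
    simpa only [innerₗ_apply_apply, hpp] using
      D.norm_sq_proj_le_inner x j (subset_convexHull ℝ _ hq)
  simp only [innerₗ_apply_apply, hpp] at hface
  set S : Set (Fin l) := {i | inner ℝ p (D.vertex x j i) = ‖p‖ ^ 2} with hS
  have himg : {q ∈ Set.range (D.vertex x j) | inner ℝ p q = ‖p‖ ^ 2} = D.vertex x j '' S := by
    ext q
    constructor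
    · rintro ⟨⟨i, rfl⟩, hi⟩
      exact ⟨i, hi, rfl⟩
    · rintro ⟨i, hi, rfl⟩
      exact ⟨⟨i, rfl⟩, hi⟩
  rw [himg] at hface
  by_cases h0 : (0 : EuclideanSpace ℝ (Fin d)) ∈ convexHull ℝ (D.v '' S) + {D.w j}
  · right
    intro y
    obtain ⟨q, hq, hq0⟩ := exists_snd_eq_zero x h0
    have h1 := hf.eval_le_branch_sub x y j (convexHull_mono (Set.image_subset_range _ _) hq)
    have h2 : inner ℝ p q = ‖p‖ ^ 2 := by
      have hconv : Convex ℝ {q | innerₗ _ p q = ‖p‖ ^ 2} :=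
        convex_hyperplane (innerₗ _ p).isLinear _
      refine convexHull_min ?_ hconv hq
      rintro _ ⟨i, hi, rfl⟩
      exact hi
    rw [D.inner_proj, D.norm_sq_proj, hq0, inner_zero_right, add_zero, ← hpdef] at h2
    rw [hq0, inner_zero_left, add_zero] at h1
    -- The constant minorant given by `q` equals the upper bound at the trial point.
    have h3 : q.fst = p.fst + ‖p.snd‖ ^ 2 / p.fst := by
      have := ha.ne
      field_simp
      linarith
    linarith
  · left
    have hne : S.Nonempty := by
      have := (convexHull_nonempty_iff (𝕜 := ℝ)).1 ⟨p, hface⟩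
      exact Set.image_nonempty.1 this
    have hsnd : p.snd ∈ convexHull ℝ (D.v '' S) + {D.w j} := by
      rw [convexHull_image_v_add_w]
      have : p.snd ∈ WithLp.sndₗ 2 ℝ ℝ (EuclideanSpace ℝ (Fin d)) ''
          convexHull ℝ (D.vertex x j '' S) := ⟨p, hface, rfl⟩
      rwa [LinearMap.image_convexHull, Set.image_image] at this
    have h1 := D.minThetaOne_le_norm_sq ⟨⟨S, hne, j, rfl⟩, h0⟩ hsnd
    have h2 := D.minThetaOne_le_one
    -- The decrease is `|a| + ‖v‖ ^ 2 / |a|`: at least `1` if `|a| ≥ 1`, at least `‖v‖ ^ 2` if `|a|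
    -- ≤ 1`.
    rcases le_total p.fst (-1) with hcase | hcase
    · have := div_nonpos_of_nonneg_of_nonpos (sq_nonneg ‖p.snd‖) ha.le
      linarith
    · have : ‖p.snd‖ ^ 2 / p.fst ≤ -‖p.snd‖ ^ 2 := by
        rw [div_le_iff_of_neg ha]
        nlinarith [sq_nonneg ‖p.snd‖]
      linarith

/-! ### Runs of the method -/

theorem exists_isRun (D : DCDecomposition d l s) (f : EuclideanSpace ℝ (Fin d) → ℝ)
    (x₀ : EuclideanSpace ℝ (Fin d)) : ∃ x M, D.IsRun f x₀ x M := by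
  classical
  have hmin : ∀ (x : EuclideanSpace ℝ (Fin d)) (M : Set (Fin s)), M.Nonempty →
      ∃ j ∈ M, ∀ i ∈ M, f (D.trial x j) ≤ f (D.trial x i) := fun x M hM =>
    Set.exists_min_image M (fun j => f (D.trial x j)) M.toFinite hM
  choose! c hcM hc using hmin
  let next : EuclideanSpace ℝ (Fin d) × Set (Fin s) → EuclideanSpace ℝ (Fin d) × Set (Fin s) :=
    fun q => (D.trial q.1 (c q.1 q.2),
      q.2 \ {j | 0 ≤ (D.proj (D.trial q.1 (c q.1 q.2)) j).fst})
  let seq : ℕ → EuclideanSpace ℝ (Fin d) × Set (Fin s) := fun n =>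
    next^[n] (x₀, Set.univ \ {j | 0 ≤ (D.proj x₀ j).fst})
  have hseq : ∀ n, seq (n + 1) = next (seq n) := fun n => Function.iterate_succ_apply' _ _ _
  refine ⟨fun n => (seq n).1, fun n => (seq n).2, rfl, rfl, fun n hn => ?_, fun n hn => ?_⟩
  · exact ⟨c (seq n).1 (seq n).2, hcM _ _ hn, hc _ _ hn, by rw [hseq]⟩
  · simp only [hseq, next]

namespace IsRun

variable {x₀ : EuclideanSpace ℝ (Fin d)} {x : ℕ → EuclideanSpace ℝ (Fin d)}
  {M : ℕ → Set (Fin s)} {n : ℕ}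

theorem fst_proj_neg (h : D.IsRun f x₀ x M) (hn : ∀ k < n, (M k).Nonempty) {j : Fin s}
    (hj : j ∈ M n) : (D.proj (x n) j).fst < 0 := by
  cases n with
  | zero =>
    rw [h.discard_zero] at hj
    exact not_le.1 hj.2
  | succ n =>
    rw [h.discard_succ n (hn n n.lt_succ_self)] at hj
    exact not_le.1 hj.2

theorem decrease_or_card_lt (h : D.IsRun f x₀ x M) (hf : D.Represents f)
    (hn : ∀ k ≤ n, (M k).Nonempty) :
    f (x (n + 1)) ≤ f (x n) ∧ ((M (n + 1)).ncard ≤ (M n).ncard ∧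
      f (x (n + 1)) ≤ f (x n) - D.minThetaOne ∨ (M (n + 1)).ncard < (M n).ncard) := by
  obtain ⟨j, hj, -, hx⟩ := h.step n (hn n le_rfl)
  have hneg := h.fst_proj_neg (fun k hk => hn k hk.le) hj
  have hM := h.discard_succ n (hn n le_rfl)
  have hsub : M (n + 1) ⊆ M n := hM ▸ Set.sdiff_subset
  refine ⟨?_, ?_⟩
  · have h1 := (hf.le_branch j _).trans (hf.branch_trial_le hneg)
    have h2 := div_nonpos_of_nonneg_of_nonpos (sq_nonneg ‖(D.proj (x n) j).snd‖) hneg.le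
    rw [hx]
    linarith
  · rcases hf.trial_decrease_or_minimizes hneg with hd | hd
    · exact Or.inl ⟨Set.ncard_le_ncard hsub (Set.toFinite _), by rwa [hx]⟩
    · refine Or.inr (Set.ncard_lt_ncard ⟨hsub, fun hsup => ?_⟩ (Set.toFinite _))
      have hj' := hsup hj
      rw [hM] at hj'
      rw [← hx] at hd
      exact hj'.2 (hf.nonneg_of_le_branch hd)

/-- The potential `|M n|` plus the floor loses at least one per update. -/
theorem add_ncard_add_floor_le (h : D.IsRun f x₀ x M) (hf : D.Represents f)
    (hb : BddBelow (Set.range f)) (hn : ∀ k < n, (M k).Nonempty) :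
    n + (M n).ncard + ⌊(f (x n) - ⨅ y, f y) / D.minThetaOne⌋₊ ≤
      s + ⌊(f x₀ - ⨅ y, f y) / D.minThetaOne⌋₊ := by
  induction n with
  | zero =>
    have hcard : (M 0).ncard ≤ s := by
      simpa using Set.ncard_le_card (M 0)
    rw [h.start]
    omega
  | succ n ih =>
    have ih := ih fun k hk => hn k (hk.trans n.lt_succ_self)
    have hpos := D.minThetaOne_pos
    obtain ⟨hle, hcase⟩ := h.decrease_or_card_lt hf (n := n) fun k hk => hn k (by omega)
    rcases hcase with ⟨hcard, hdec⟩ | hcard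
    · have hfl : ⌊(f (x (n + 1)) - ⨅ y, f y) / D.minThetaOne⌋₊ + 1 ≤
          ⌊(f (x n) - ⨅ y, f y) / D.minThetaOne⌋₊ := by
        rw [← Nat.floor_add_one (div_nonneg (sub_nonneg.2 (ciInf_le hb _)) hpos.le)]
        refine Nat.floor_le_floor ?_
        rw [div_add_one hpos.ne']
        gcongr
        linarith
      omega
    · have hfl : ⌊(f (x (n + 1)) - ⨅ y, f y) / D.minThetaOne⌋₊ ≤
          ⌊(f (x n) - ⨅ y, f y) / D.minThetaOne⌋₊ := by
        gcongr
      omega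

theorem le_branch_of_notMem (h : D.IsRun f x₀ x M) (hf : D.Represents f)
    (hb : BddBelow (Set.range f)) (hn : ∀ k < n, (M k).Nonempty) {j : Fin s} (hj : j ∉ M n)
    (y : EuclideanSpace ℝ (Fin d)) : f (x n) ≤ D.branch j y := by
  induction n with
  | zero =>
    rw [h.discard_zero] at hj
    exact hf.le_branch_of_nonneg hb (by simpa using hj) y
  | succ n ih =>
    by_cases hjn : j ∈ M n
    · rw [h.discard_succ n (hn n n.lt_succ_self)] at hj
      exact hf.le_branch_of_nonneg hb (by simpa [hjn] using hj) y
    · exact (h.decrease_or_card_lt hf fun k hk => hn k (by omega)).1.trans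
        (ih (fun k hk => hn k (by omega)) hjn)

theorem exists_termination (h : D.IsRun f x₀ x M) (hf : D.Represents f) (hb : BddBelow (Set.range f)) :
    ∃ N ≤ s * D.nStar f x₀, M N = ∅ ∧ (∀ n < N, (M n).Nonempty) ∧ ∀ y, f (x N) ≤ f y := by
  classical
  set B := ⌊(f x₀ - ⨅ y, f y) / D.minThetaOne⌋₊ with hB
  -- The potential gives the bound `s + B`, which is at most `s * (B + 1)` because `s ≥ 1`.
  have hex : ∃ n, n ≤ s + B ∧ M n = ∅ := by
    by_contra! hcon
    have hle := h.add_ncard_add_floor_le hf hb (n := s + B) fun k hk => hcon k hk.le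
    have := (Set.ncard_pos (Set.toFinite _)).2 (hcon (s + B) le_rfl)
    omega
  obtain ⟨hN, hempty⟩ := Nat.find_spec hex
  have hne : ∀ n < Nat.find hex, (M n).Nonempty := fun n hn =>
    Set.nonempty_iff_ne_empty.2 fun h0 => Nat.find_min hex hn ⟨hn.le.trans hN, h0⟩
  refine ⟨Nat.find hex, ?_, hempty, hne, fun y => ?_⟩
  · have hs : 1 ≤ s := Nat.one_le_iff_ne_zero.2 (NeZero.ne s)
    refine hN.trans ?_
    rw [nStar, ← hB]
    nlinarith
  · obtain ⟨j, hj⟩ := hf.exists_eq_branch y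
    rw [hj]
    exact h.le_branch_of_notMem hf hb hne (by simp [hempty]) y

end IsRun

end

end DCDecomposition

theorem theorem3 {d : ℕ} (f : EuclideanSpace ℝ (Fin d) → ℝ) (hf : IsPiecewiseAffine f)
    (hb : BddBelow (Set.range f)) :
    (∃ x, ∀ y, f x ≤ f y) ∧
    (∃ (l s : ℕ) (_ : NeZero l) (_ : NeZero s) (D : DCDecomposition d l s), D.Represents f) ∧
    ∀ (l s : ℕ) [NeZero l] [NeZero s] (D : DCDecomposition d l s), D.Represents f →
      ∀ x₀ : EuclideanSpace ℝ (Fin d),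
        (∃ x M, D.IsRun f x₀ x M) ∧
        ∀ (x : ℕ → EuclideanSpace ℝ (Fin d)) (M : ℕ → Set (Fin s)), D.IsRun f x₀ x M →
          ∃ N ≤ s * D.nStar f x₀,
            M N = ∅ ∧ (∀ n < N, (M n).Nonempty) ∧ ∀ y, f (x N) ≤ f y := by
  refine ⟨?_, hf.exists_represents, fun l s _ _ D hD x₀ =>
    ⟨D.exists_isRun f x₀, fun x M h => h.exists_termination hD hb⟩⟩
  obtain ⟨l, s, _, _, D, hD⟩ := hf.exists_represents
  obtain ⟨x, M, h⟩ := D.exists_isRun f 0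
  obtain ⟨N, -, -, -, hN⟩ := h.exists_termination hD hb
  exact ⟨x N, hN⟩
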